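/- There is an absolute constant $K>0$ such that the following holds. Let $m\ge 2$ be an integer, let $C\subseteq\{0,1\}^m$ be any set of vectors (a code), let $w:[m]\to\mathbb{R}_{\ge 0}$ be any weights, and let $\varepsilon>0$. Then there exist weights $\widetilde w:[m]\to\mathbb{R}_{\ge 0}$ that form a $(1\pm\varepsilon)$ sparsifier of $C$, that is, $$(1-\varepsilon)\sum_{i=1}^m w(i)c_i\ \le\ \sum_{i=1}^m \widetilde w(i)c_i\ \le\ (1+\varepsilon)\sum_{i=1}^m w(i)c_i\qquad\text{for every } c\in C,$$ and such that $$|\{i\in[m]:\widetilde w(i)\ne 0\}|\ \le\ K\cdot\frac{\mathrm{CL}(C)\,(\log m)^2\,(\log\log m)^2}{\varepsilon^2},$$ where $\log$ is the natural logarithm. Here the chain length $\mathrm{CL}(C)$ is the largest $\ell\ge 0$ for which there are injective maps $a:[\ell]\to[m]$ and $c:[\ell]\to C$ with $c(i)_{a(i)}=1$ for all $i\in[\ell]$ and $c(i)_{a(j)}=0$ for all $1\le i<j\le\ell$. -/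

import Mathlib

open scoped NNReal

/-- A code of length `m`: a set of codewords in `{0,1}^m`. -/
abbrev Code (m : ℕ) : Type := Set (Fin m → Bool)

namespace Code

variable {m : ℕ}

/-- A chain of length `ℓ` in `C`: injective maps `a : [ℓ] → [m]` and `c : [ℓ] → C` with
`c(i)_{a(i)} = 1` for all `i`, and `c(i)_{a(j)} = 0` for all `i < j`. -/
structure IsChainPair (C : Code m) {ℓ : ℕ} (a : Fin ℓ → Fin m) (c : Fin ℓ → C) : Prop where
  injective_coord : Function.Injective a
  injective_word : Function.Injective c
  diag : ∀ i, (c i : Fin m → Bool) (a i) = true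
  upper : ∀ i j, i < j → (c i : Fin m → Bool) (a j) = false

/-- `C` has a chain of length `ℓ`. -/
def HasChain (C : Code m) (ℓ : ℕ) : Prop :=
  ∃ (a : Fin ℓ → Fin m) (c : Fin ℓ → C), IsChainPair C a c

/-- The chain length `CL(C)`: the length of the longest chain in `C`
(a maximum, see `isGreatest_chainLength`). -/
noncomputable def chainLength (C : Code m) : ℕ := sSup {ℓ | HasChain C ℓ}

theorem isGreatest_chainLength (C : Code m) :
    IsGreatest {ℓ | HasChain C ℓ} (chainLength C) := by
  have hbdd : BddAbove {ℓ | HasChain C ℓ} := by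
    refine ⟨m, ?_⟩
    rintro ℓ ⟨a, c, h⟩
    simpa using Fintype.card_le_of_injective a h.injective_coord
  have hne : {ℓ | HasChain C ℓ}.Nonempty :=
    ⟨0, Fin.elim0, Fin.elim0, fun i => i.elim0, fun i => i.elim0, fun i => i.elim0,
      fun i => i.elim0⟩
  exact ⟨Nat.sSup_mem hne hbdd, fun _ h => le_csSup hbdd h⟩

/-- The weighted size `⟨w, c⟩ = ∑ i, w(i) c_i` of a codeword. -/
noncomputable def weight (w : Fin m → ℝ≥0) (c : Fin m → Bool) : ℝ :=
  ∑ i, (w i : ℝ) * (if c i then 1 else 0)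

/-- `w'` is a `(1 ± ε)` sparsifier of the code `C` with weights `w`. -/
def IsSparsifier (C : Code m) (w : Fin m → ℝ≥0) (ε : ℝ) (w' : Fin m → ℝ≥0) : Prop :=
  ∀ c ∈ C, weight w' c ∈ Set.Icc ((1 - ε) * weight w c) ((1 + ε) * weight w c)

end Code

/-! Codewords become sets, and chain length becomes a rank `rk` on set families. Call a family
`d`-spread when every contraction (the members avoiding some `S`) has support of weight at least `d`
times its rank.

Spread families have few light members: `sum_exp_neg_weight_lt` bounds a sum of exponentials over
the nonempty members, like a cut-counting bound obtained by random contraction. This is the union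
bound needed to sparsify by independent sampling (`exists_sample`).

Any family becomes spread after deleting coordinates whose weight is paid for by a drop in rank
(`exists_spread_restrict`). Doing this at the scales `d * 2 ^ j` cuts the coordinates into layers.
Sampling layer `j` costs about `log m / (σ * η)` times its rank drop, so the costs telescope to the
rank of the whole family.

A word of weight `X` does not meet layers with `d * 2 ^ j > X`, and layers far below that scale
weigh little, so only `O(log m)` layers contribute an error `η * X`. Taking `σ` of order `ε` and `η`
of order `ε / log m` gives support `O(CL * log² m / ε²)`. The log log factor is needed only through
a positive lower bound. -/

open Finset

/-! ### Chains, rank, contraction and restriction. -/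

namespace SetFamily

variable {α : Type*}

/-- `l` is a chain of `D`: every entry is separated from the later ones by a member of `D`. -/
def IsChain (D : Finset (Finset α)) : List α → Prop
  | [] => True
  | a :: l => (∃ c ∈ D, a ∈ c ∧ ∀ b ∈ l, b ∉ c) ∧ IsChain D l

/-- The length of the longest chain of `D`. -/
noncomputable def rk (D : Finset (Finset α)) : ℕ :=
  sSup {n | ∃ l, IsChain D l ∧ l.length = n}

theorem IsChain.nodup {D : Finset (Finset α)} : ∀ {l : List α}, IsChain D l → l.Nodup
  | [], _ => List.nodup_nil
  | _ :: _, ⟨⟨_, _, hac, hb⟩, hl⟩ => List.nodup_cons.2 ⟨fun h => hb _ h hac, hl.nodup⟩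

theorem IsChain.append {D E : Finset (Finset α)} (hED : E ⊆ D) {l₂ : List α}
    (h₂ : IsChain D l₂) (h : ∀ c ∈ E, ∀ b ∈ l₂, b ∉ c) :
    ∀ {l₁ : List α}, IsChain E l₁ → IsChain D (l₁ ++ l₂)
  | [], _ => h₂
  | _ :: _, ⟨⟨c, hc, hac, hb⟩, hl⟩ =>
    ⟨⟨c, hED hc, hac, fun b hbm => (List.mem_append.1 hbm).elim (hb b) (h c hc b)⟩,
      h₂.append hED h hl⟩

variable [DecidableEq α]

/-- The members of `D` that avoid `S`. -/
def contract (D : Finset (Finset α)) (S : Finset α) : Finset (Finset α) :=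
  D.filter (Disjoint S)

/-- The traces on `V` of the members of `D`. -/
def restrict (D : Finset (Finset α)) (V : Finset α) : Finset (Finset α) :=
  D.image (· ∩ V)

/-- The union of the members of `D`. -/
def supp (D : Finset (Finset α)) : Finset α := D.biUnion id

theorem mem_contract {D : Finset (Finset α)} {S c : Finset α} :
    c ∈ contract D S ↔ c ∈ D ∧ Disjoint S c := by
  simp [contract]

theorem mem_restrict {D : Finset (Finset α)} {V c : Finset α} :
    c ∈ restrict D V ↔ ∃ b ∈ D, b ∩ V = c := by
  simp [restrict]

theorem mem_supp {D : Finset (Finset α)} {i : α} : i ∈ supp D ↔ ∃ c ∈ D, i ∈ c := by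
  simp [supp]

theorem contract_contract (D : Finset (Finset α)) (S T : Finset α) :
    contract (contract D S) T = contract D (S ∪ T) := by
  ext c
  simp [mem_contract, Finset.disjoint_union_left, and_assoc]

theorem restrict_restrict (D : Finset (Finset α)) (V U : Finset α) :
    restrict (restrict D V) U = restrict D (V ∩ U) := by
  ext c
  simp [mem_restrict, Finset.inter_assoc]

theorem IsChain.mem_supp {D : Finset (Finset α)} :
    ∀ {l : List α}, IsChain D l → ∀ a ∈ l, a ∈ supp D
  | [], _, _, h => by simp at h
  | a :: l, ⟨⟨c, hc, hac, _⟩, hl⟩, b, hb => by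
    rcases List.mem_cons.1 hb with rfl | hb
    · exact SetFamily.mem_supp.2 ⟨c, hc, hac⟩
    · exact hl.mem_supp b hb

theorem IsChain.length_le {D : Finset (Finset α)} {l : List α} (h : IsChain D l) :
    l.length ≤ (supp D).card := by
  rw [← List.toFinset_card_of_nodup h.nodup]
  exact Finset.card_le_card fun a ha => h.mem_supp a (List.mem_toFinset.1 ha)

theorem IsChain.of_restrict {D : Finset (Finset α)} {V : Finset α} :
    ∀ {l : List α}, IsChain (restrict D V) l → IsChain D l ∧ ∀ a ∈ l, a ∈ V
  | [], _ => ⟨trivial, by simp⟩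
  | a :: l, ⟨⟨c, hc, hac, hb⟩, hl⟩ => by
    obtain ⟨e, he, rfl⟩ := mem_restrict.1 hc
    obtain ⟨h₁, h₂⟩ := hl.of_restrict
    rw [Finset.mem_inter] at hac
    refine ⟨⟨⟨e, he, hac.1,
      fun b hbl hbe => hb b hbl (Finset.mem_inter.2 ⟨hbe, h₂ b hbl⟩)⟩, h₁⟩, ?_⟩
    intro b hb'
    rcases List.mem_cons.1 hb' with rfl | hb'
    · exact hac.2
    · exact h₂ b hb'

theorem rk_isGreatest (D : Finset (Finset α)) :
    IsGreatest {n | ∃ l, IsChain D l ∧ l.length = n} (rk D) := by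
  have hb : BddAbove {n | ∃ l, IsChain D l ∧ l.length = n} :=
    ⟨(supp D).card, by rintro _ ⟨l, hl, rfl⟩; exact hl.length_le⟩
  exact ⟨Nat.sSup_mem ⟨0, [], trivial, rfl⟩ hb, fun _ h => le_csSup hb h⟩

theorem exists_chain (D : Finset (Finset α)) : ∃ l, IsChain D l ∧ l.length = rk D :=
  (rk_isGreatest D).1

theorem IsChain.length_le_rk {D : Finset (Finset α)} {l : List α} (h : IsChain D l) :
    l.length ≤ rk D :=
  (rk_isGreatest D).2 ⟨l, h, rfl⟩

theorem rk_le_card_supp (D : Finset (Finset α)) : rk D ≤ (supp D).card := by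
  obtain ⟨l, hl, h⟩ := exists_chain D
  exact h ▸ hl.length_le

theorem rk_restrict_le (D : Finset (Finset α)) (V : Finset α) : rk (restrict D V) ≤ rk D := by
  obtain ⟨l, hl, h⟩ := exists_chain (restrict D V)
  exact h ▸ hl.of_restrict.1.length_le_rk

theorem contract_subset (D : Finset (Finset α)) (S : Finset α) : contract D S ⊆ D :=
  Finset.filter_subset _ _

/-- Members of the contraction miss everything outside its support, so a chain of the contraction
can be put in front of a chain living outside that support. -/
theorem rk_contract_add_rk_restrict_le [Fintype α] (D : Finset (Finset α)) (S : Finset α) :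
    rk (contract D S) + rk (restrict D (supp (contract D S))ᶜ) ≤ rk D := by
  obtain ⟨l₁, h₁, e₁⟩ := exists_chain (contract D S)
  obtain ⟨l₂, h₂, e₂⟩ := exists_chain (restrict D (supp (contract D S))ᶜ)
  rw [← e₁, ← e₂, ← List.length_append]
  refine (h₂.of_restrict.1.append (contract_subset D S) (fun c hc b hb hbc => ?_) h₁).length_le_rk
  exact Finset.mem_compl.1 (h₂.of_restrict.2 b hb) (SetFamily.mem_supp.2 ⟨c, hc, hbc⟩)

theorem rk_contract_singleton_lt {D : Finset (Finset α)} {i : α} (hi : i ∈ supp D) :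
    rk (contract D {i}) < rk D := by
  obtain ⟨l, h, e⟩ := exists_chain (contract D {i})
  obtain ⟨c, hc, hic⟩ := SetFamily.mem_supp.1 hi
  have hs : IsChain D [i] := ⟨⟨c, hc, hic, by simp⟩, trivial⟩
  have := (hs.append (contract_subset D {i}) (fun c hc b hb hbc => ?_) h).length_le_rk
  · simp at this
    omega
  · obtain rfl := List.mem_singleton.1 hb
    simpa [hbc] using (mem_contract.1 hc).2

theorem rk_pos {D : Finset (Finset α)} {c : Finset α} (hc : c ∈ D) (hne : c.Nonempty) :
    0 < rk D := by
  obtain ⟨i, hi⟩ := hne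
  exact (Nat.zero_le _).trans_lt (rk_contract_singleton_lt (SetFamily.mem_supp.2 ⟨c, hc, hi⟩))

/-- Every member other than the full support misses some point of the support, hence lies in one of
at most `Fintype.card α` contractions of smaller rank. -/
theorem card_le_pow_rk [Fintype α] (r : ℕ) : ∀ D : Finset (Finset α), rk D ≤ r →
    D.card ≤ (Fintype.card α + 1) ^ r := by
  induction r with
  | zero =>
    intro D hD
    rw [pow_zero, Finset.card_le_one]
    have h0 : ∀ c ∈ D, c = ∅ := fun c hc => by
      by_contra hne
      exact absurd (rk_pos hc (Finset.nonempty_iff_ne_empty.2 hne)) (by omega)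
    intro a ha b hb
    rw [h0 a ha, h0 b hb]
  | succ r ih =>
    intro D hD
    have hsub : D ⊆ insert (supp D) ((supp D).biUnion fun i => contract D {i}) := by
      intro c hc
      rw [Finset.mem_insert, Finset.mem_biUnion]
      by_cases h : supp D ⊆ c
      · left
        exact Finset.Subset.antisymm (fun i hi => SetFamily.mem_supp.2 ⟨c, hc, hi⟩) h
      · right
        obtain ⟨i, hi, hic⟩ := Finset.not_subset.1 h
        exact ⟨i, hi, mem_contract.2 ⟨hc, by simpa using hic⟩⟩
    have hU : ((supp D).biUnion fun i => contract D {i}).card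
        ≤ (supp D).card * (Fintype.card α + 1) ^ r :=
      Finset.card_biUnion_le_card_mul _ _ _ fun i hi =>
        ih _ (by have := rk_contract_singleton_lt hi; omega)
    have h1 : 1 ≤ (Fintype.card α + 1) ^ r := Nat.one_le_pow _ _ (by omega)
    calc D.card ≤ _ := Finset.card_le_card hsub
      _ ≤ _ + 1 := Finset.card_insert_le _ _
      _ ≤ Fintype.card α * (Fintype.card α + 1) ^ r + (Fintype.card α + 1) ^ r := by
        gcongr
        exact hU.trans (Nat.mul_le_mul_right _ (Finset.card_le_univ _))
      _ = (Fintype.card α + 1) ^ (r + 1) := by ring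

/-! ### Spread families. -/

/-- Every contraction of `D` has support of weight at least `d` times its chain length. -/
def Spread (w : α → ℝ) (d : ℝ) (D : Finset (Finset α)) : Prop :=
  ∀ S, d * rk (contract D S) ≤ ∑ i ∈ supp (contract D S), w i

theorem Spread.contract {w : α → ℝ} {d : ℝ} {D : Finset (Finset α)} (h : Spread w d D)
    (S : Finset α) : Spread w d (contract D S) := fun T => by
  rw [contract_contract]
  exact h _

theorem contract_empty (D : Finset (Finset α)) : contract D ∅ = D := by
  simp [SetFamily.contract]

theorem Spread.le_supp {w : α → ℝ} {d : ℝ} {D : Finset (Finset α)} (h : Spread w d D) :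
    d * rk D ≤ ∑ i ∈ supp D, w i := by
  simpa [contract_empty] using h ∅

/-- Contract by the complement of `c`: the survivors lie inside `c`, and `c` is one of them, so the
rank is at least 1. -/
theorem Spread.le_sum [Fintype α] {w : α → ℝ} (hw : ∀ i, 0 ≤ w i) {d : ℝ} (hd : 0 ≤ d)
    {D : Finset (Finset α)} (h : Spread w d D) {c : Finset α} (hc : c ∈ D) (hne : c.Nonempty) :
    d ≤ ∑ i ∈ c, w i := by
  have h1 : (1 : ℝ) ≤ rk (SetFamily.contract D cᶜ) := by
    exact_mod_cast rk_pos (mem_contract.2 ⟨hc, disjoint_compl_left⟩) hne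
  refine (le_mul_of_one_le_right hd h1).trans ((h cᶜ).trans ?_)
  refine Finset.sum_le_sum_of_subset_of_nonneg (fun i hi => ?_) fun i _ _ => hw i
  obtain ⟨e, he, hie⟩ := SetFamily.mem_supp.1 hi
  by_contra hic
  exact Finset.disjoint_left.1 (mem_contract.1 he).2 (Finset.mem_compl.2 hic) hie

/-- A contraction violating spreadness has a support lighter than `d` times its rank. Deleting that
support lowers the rank by at least as much, so deletion can be iterated and the charges add up. -/
theorem exists_spread_restrict [Fintype α] {w : α → ℝ} (hw : ∀ i, 0 ≤ w i) (d : ℝ)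
    (D : Finset (Finset α)) :
    ∃ U : Finset α, Spread w d (restrict D Uᶜ) ∧
      ∑ i ∈ U, w i ≤ d * ((rk D : ℝ) - rk (restrict D Uᶜ)) := by
  induction hr : rk D using Nat.strong_induction_on generalizing D with
  | _ r ih =>
    by_cases h : Spread w d D
    · refine ⟨∅, ?_, ?_⟩ <;>
      simp [restrict, h, hr]
    · simp only [Spread, not_forall, not_le] at h
      obtain ⟨S, hS⟩ := h
      have hpos : 0 < rk (contract D S) := by
        rcases Nat.eq_zero_or_pos (rk (contract D S)) with h0 | h0
        · rw [h0, Nat.cast_zero, mul_zero] at hS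
          exact absurd hS (not_lt.2 (Finset.sum_nonneg fun i _ => hw i))
        · exact h0
      have hadd := rk_contract_add_rk_restrict_le D S
      set T := supp (contract D S) with hT
      obtain ⟨U, hU, hwU⟩ := ih _ (by omega) (restrict D Tᶜ) rfl
      have hc : Tᶜ ∩ Uᶜ = (T ∪ U)ᶜ := by simp [Finset.compl_union]
      rw [restrict_restrict, hc] at hU hwU
      refine ⟨T ∪ U, hU, ?_⟩
      have h1 : ∑ i ∈ T ∪ U, w i ≤ ∑ i ∈ T, w i + ∑ i ∈ U, w i := by
        rw [← Finset.sum_union_inter]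
        exact le_add_of_nonneg_right (Finset.sum_nonneg fun i _ => hw i)
      have hd : 0 ≤ d := by
        by_contra hd
        have : d * (rk (contract D S) : ℝ) ≤ 0 :=
          mul_nonpos_of_nonpos_of_nonneg (not_le.1 hd).le (Nat.cast_nonneg _)
        exact absurd (hS.trans_le this) (not_lt.2 (Finset.sum_nonneg fun i _ => hw i))
      have h2 : (rk (contract D S) : ℝ) + rk (restrict D Tᶜ) ≤ r := by
        exact_mod_cast hr ▸ hadd
      nlinarith [mul_le_mul_of_nonneg_left h2 hd]

/-! ### Counting light members by random contraction. -/

theorem one_le_one_sub_mul_exp {y z : ℝ} (hy0 : 0 ≤ y) (hy : y ≤ 1 / 2) (hz : 2 * y ≤ z) :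
    1 ≤ (1 - y) * Real.exp z := by
  have h1 : 1 + 2 * y ≤ Real.exp z := by linarith [Real.add_one_le_exp z]
  nlinarith [mul_le_mul_of_nonneg_left h1 (show 0 ≤ 1 - y by linarith)]

/-- Contract a point `i` chosen with probability `w i / W`. A light set survives with probability `1
- x / W ≥ exp (-2 * x / W)`, and this loss is repaid by lowering `θ` by `2 / (r + 1)`. -/
theorem exp_le_sum_contract {w : α → ℝ} (hw : ∀ i, 0 ≤ w i) {d : ℝ} (hd : 0 < d) {r : ℕ}
    {U c : Finset α} (hc : c ⊆ U) (hU : d * ((r : ℝ) + 1) ≤ ∑ i ∈ U, w i)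
    (hsmall : ∑ i ∈ c, w i ≤ (∑ i ∈ U, w i) / 2) (θ : ℝ) :
    Real.exp (-(θ * (∑ i ∈ c, w i) / d)) ≤ ∑ i ∈ U, w i / (∑ i ∈ U, w i) *
      (if i ∈ c then 0 else Real.exp (-((θ - 2 / ((r : ℝ) + 1)) * (∑ i ∈ c, w i) / d))) := by
  set W := ∑ i ∈ U, w i with hW
  set x := ∑ i ∈ c, w i with hx
  have hr : (0 : ℝ) < (r : ℝ) + 1 := by positivity
  have hWpos : 0 < W := lt_of_lt_of_le (by positivity) hU
  have hx0 : 0 ≤ x := Finset.sum_nonneg fun i _ => hw i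
  have hsum : ∑ i ∈ U, w i / W * (if i ∈ c then 0 else
      Real.exp (-((θ - 2 / ((r : ℝ) + 1)) * x / d)))
      = (1 - x / W) * Real.exp (-((θ - 2 / ((r : ℝ) + 1)) * x / d)) := by
    have : ∀ i ∈ U, w i / W * (if i ∈ c then 0 else
        Real.exp (-((θ - 2 / ((r : ℝ) + 1)) * x / d)))
        = (w i - if i ∈ c then w i else 0) *
          (Real.exp (-((θ - 2 / ((r : ℝ) + 1)) * x / d)) / W) := by
      intro i _
      split_ifs
      · simp
      · ring
    rw [Finset.sum_congr rfl this, ← Finset.sum_mul, Finset.sum_sub_distrib,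
      Finset.sum_ite_mem, Finset.inter_eq_right.2 hc, ← hW, ← hx]
    field_simp
  rw [hsum]
  have hz : 2 * (x / W) ≤ 2 / ((r : ℝ) + 1) * x / d := by
    have : x / W ≤ x / (d * ((r : ℝ) + 1)) :=
      div_le_div_of_nonneg_left hx0 (by positivity) hU
    calc 2 * (x / W) ≤ 2 * (x / (d * ((r : ℝ) + 1))) := by linarith
      _ = _ := by field_simp
  have h1 := one_le_one_sub_mul_exp (div_nonneg hx0 hWpos.le)
    (by rw [div_le_iff₀ hWpos]; linarith) hz
  have h2 : Real.exp (-((θ - 2 / ((r : ℝ) + 1)) * x / d))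
      = Real.exp (2 / ((r : ℝ) + 1) * x / d) * Real.exp (-(θ * x / d)) := by
    rw [← Real.exp_add]
    congr 1
    ring
  rw [h2, ← mul_assoc]
  exact le_mul_of_one_le_left (Real.exp_pos _).le h1

/-- There are at most `(n + 1) ^ r` sets, where `n` is the number of points, and each term is at
most `(n + 1) ^ (-2 * r)`. -/
theorem sum_large_exp_le [Fintype α] {w : α → ℝ} {d : ℝ} (hd : 0 < d) {r : ℕ}
    {D E : Finset (Finset α)} (hE : E ⊆ D) (hD : rk D ≤ r) {θ : ℝ}
    (hlarge : ∀ c ∈ E, d * (r : ℝ) / 2 ≤ ∑ i ∈ c, w i)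
    (hθ : 4 * Real.log (Fintype.card α + 1) ≤ θ) :
    ∑ c ∈ E, Real.exp (-(θ * (∑ i ∈ c, w i) / d)) ≤ ((Fintype.card α + 1 : ℝ)⁻¹) ^ r := by
  have hN : (0 : ℝ) < Fintype.card α + 1 := by positivity
  have hlog : 0 ≤ Real.log (Fintype.card α + 1) := Real.log_nonneg (by simp)
  have hterm : ∀ c ∈ E, Real.exp (-(θ * (∑ i ∈ c, w i) / d))
      ≤ ((Fintype.card α + 1 : ℝ)⁻¹) ^ (2 * r) := by
    intro c hc
    have : ((Fintype.card α + 1 : ℝ)⁻¹) ^ (2 * r)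
        = Real.exp (-((2 * r : ℕ) * Real.log (Fintype.card α + 1))) := by
      rw [Real.exp_neg, Real.exp_nat_mul, Real.exp_log hN, inv_pow]
    rw [this]
    apply Real.exp_le_exp.2
    apply neg_le_neg
    rw [le_div_iff₀ hd]
    push_cast
    calc 2 * (r : ℝ) * Real.log (Fintype.card α + 1) * d
        = 4 * Real.log (Fintype.card α + 1) * (d * r / 2) := by ring
      _ ≤ θ * (∑ i ∈ c, w i) :=
        mul_le_mul hθ (hlarge c hc) (by positivity) (by linarith)
  have hcard : (E.card : ℝ) ≤ (Fintype.card α + 1 : ℝ) ^ r := by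
    exact_mod_cast (Finset.card_le_card hE).trans (card_le_pow_rk r D hD)
  calc _ ≤ ∑ c ∈ E, ((Fintype.card α + 1 : ℝ)⁻¹) ^ (2 * r) := Finset.sum_le_sum hterm
    _ = E.card * ((Fintype.card α + 1 : ℝ)⁻¹) ^ (2 * r) := by
      rw [Finset.sum_const, nsmul_eq_mul]
    _ ≤ (Fintype.card α + 1 : ℝ) ^ r * ((Fintype.card α + 1 : ℝ)⁻¹) ^ (2 * r) := by gcongr
    _ = _ := by rw [two_mul, pow_add, ← mul_assoc, ← mul_pow, mul_inv_cancel₀ hN.ne', one_pow,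
      one_mul]

/-- Induction on the rank. Sets heavier than half the support are counted crudely; the others are
averaged over one-point contractions, of smaller rank and still spread. The losses `2 / (r + 1)` in
`θ` sum to `2 * harmonic r`. -/
theorem sum_exp_neg_weight_le [Fintype α] {w : α → ℝ} (hw : ∀ i, 0 ≤ w i) {d : ℝ} (hd : 0 < d)
    (r : ℕ) : ∀ (D : Finset (Finset α)) (θ : ℝ), rk D ≤ r → Spread w d D →
      2 * (harmonic r : ℝ) + 4 * Real.log (Fintype.card α + 1) ≤ θ →
      ∑ c ∈ D.erase ∅, Real.exp (-(θ * (∑ i ∈ c, w i) / d))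
        ≤ ∑ s ∈ range r, ((Fintype.card α + 1 : ℝ)⁻¹) ^ (s + 1) := by
  induction r with
  | zero =>
    intro D θ hD _ _
    have : D.erase ∅ = ∅ := by
      rw [Finset.eq_empty_iff_forall_notMem]
      intro c hc
      rw [Finset.mem_erase] at hc
      exact absurd (rk_pos hc.2 (Finset.nonempty_iff_ne_empty.2 hc.1)) (by omega)
    simp [this]
  | succ r ih =>
    intro D θ hD hS hθ
    have hh : (harmonic (r + 1) : ℝ) = harmonic r + 1 / ((r : ℝ) + 1) := by
      rw [harmonic_succ]
      push_cast
      ring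
    have hr : (0 : ℝ) < (r : ℝ) + 1 := by positivity
    have hinv : (0 : ℝ) < 1 / ((r : ℝ) + 1) := by positivity
    have hhr : (0 : ℝ) ≤ harmonic r := by
      rw [harmonic]; push_cast; positivity
    rw [Finset.sum_range_succ]
    rcases hD.lt_or_eq with hlt | heq
    · refine (ih D θ (by omega) hS (by rw [hh] at hθ; linarith)).trans ?_
      exact le_add_of_nonneg_right (by positivity)
    set W := ∑ i ∈ supp D, w i with hW
    have hWle : d * ((r : ℝ) + 1) ≤ W := by
      have := hS.le_supp
      rw [heq] at this
      exact_mod_cast this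
    have hWpos : 0 < W := lt_of_lt_of_le (by positivity) hWle
    rw [← Finset.sum_filter_add_sum_filter_not (D.erase ∅) (fun c => ∑ i ∈ c, w i ≤ W / 2)]
    refine add_le_add ?_ ?_
    · set θ' := θ - 2 / ((r : ℝ) + 1) with hθ'
      have hθ'le : 2 * (harmonic r : ℝ) + 4 * Real.log (Fintype.card α + 1) ≤ θ' := by
        rw [hh] at hθ
        have : 2 / ((r : ℝ) + 1) = 2 * (1 / ((r : ℝ) + 1)) := by ring
        rw [hθ', this]
        linarith
      calc _ ≤ ∑ c ∈ (D.erase ∅).filter (fun c => ∑ i ∈ c, w i ≤ W / 2),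
            ∑ i ∈ supp D, w i / W *
              (if i ∈ c then 0 else Real.exp (-(θ' * (∑ i ∈ c, w i) / d))) := by
            refine Finset.sum_le_sum fun c hc => ?_
            rw [Finset.mem_filter, Finset.mem_erase] at hc
            exact exp_le_sum_contract hw hd
              (fun i hi => mem_supp.2 ⟨c, hc.1.2, hi⟩) hWle hc.2 θ
        _ = ∑ i ∈ supp D, w i / W *
            ∑ c ∈ (D.erase ∅).filter (fun c => ∑ i ∈ c, w i ≤ W / 2),
              (if i ∈ c then 0 else Real.exp (-(θ' * (∑ i ∈ c, w i) / d))) := by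
            rw [Finset.sum_comm]
            simp_rw [Finset.mul_sum]
        _ ≤ ∑ i ∈ supp D, w i / W * ∑ s ∈ range r, ((Fintype.card α + 1 : ℝ)⁻¹) ^ (s + 1) := by
            refine Finset.sum_le_sum fun i hi => ?_
            refine mul_le_mul_of_nonneg_left ?_ (div_nonneg (hw i) hWpos.le)
            refine le_trans ?_ (ih (contract D {i}) θ'
              (by have := rk_contract_singleton_lt hi; omega) (hS.contract _) hθ'le)
            rw [← Finset.sum_filter_of_ne (p := fun c => i ∉ c) (by
              intro c _ h hic
              exact h (if_pos hic))]
            refine (Finset.sum_le_sum fun c hc => ?_).trans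
              (Finset.sum_le_sum_of_subset_of_nonneg (fun c hc => ?_)
                fun c _ _ => (Real.exp_pos _).le)
            · rw [if_neg (Finset.mem_filter.1 hc).2]
            · simp only [Finset.mem_filter, Finset.mem_erase] at hc
              exact Finset.mem_erase.2 ⟨hc.1.1.1, mem_contract.2
                ⟨hc.1.1.2, Finset.disjoint_singleton_left.2 hc.2⟩⟩
        _ = _ := by
            rw [← Finset.sum_mul, ← Finset.sum_div, ← hW, div_self hWpos.ne', one_mul]
    · refine sum_large_exp_le hd ((Finset.filter_subset _ _).trans (Finset.erase_subset _ _))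
        hD (fun c hc => ?_) (by
          have : (0 : ℝ) ≤ harmonic (r + 1) := by rw [hh]; positivity
          linarith)
      have := (Finset.mem_filter.1 hc).2
      push_cast
      linarith

theorem sum_inv_pow_lt {x : ℝ} (hx : 3 ≤ x) (r : ℕ) :
    ∑ s ∈ range r, (x⁻¹) ^ (s + 1) < 1 / 2 := by
  have h : ∀ r : ℕ, ∑ s ∈ range r, (x⁻¹) ^ (s + 1) ≤ 1 / 2 - 1 / 2 * (1 / 3 : ℝ) ^ r := by
    have hx' : x⁻¹ ≤ 1 / 3 := by
      rw [one_div]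
      exact inv_anti₀ (by norm_num) hx
    intro r
    induction r with
    | zero => simp
    | succ r ih =>
      rw [Finset.sum_range_succ]
      have : (x⁻¹) ^ (r + 1) ≤ (1 / 3 : ℝ) ^ (r + 1) :=
        pow_le_pow_left₀ (by positivity) hx' _
      rw [pow_succ (1 / 3 : ℝ)] at this ⊢
      linarith
  have := h r
  have h3 : (0 : ℝ) < (1 / 3 : ℝ) ^ r := by positivity
  linarith

theorem sum_exp_neg_weight_lt [Fintype α] {w : α → ℝ} (hw : ∀ i, 0 ≤ w i) {d : ℝ} (hd : 0 < d)
    (hα : 2 ≤ Fintype.card α) {D : Finset (Finset α)} (hD : Spread w d D) :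
    ∑ c ∈ D.erase ∅, Real.exp (-(8 * Real.log (Fintype.card α + 1) * (∑ i ∈ c, w i) / d))
      < 1 / 2 := by
  have h2 : (2 : ℝ) ≤ Fintype.card α := by exact_mod_cast hα
  refine (sum_exp_neg_weight_le hw hd (Fintype.card α) D _
    ((rk_le_card_supp D).trans (Finset.card_le_univ _)) hD ?_).trans_lt
    (sum_inv_pow_lt (by linarith) _)
  have h1 := harmonic_le_one_add_log (Fintype.card α)
  have h3 : Real.log (Fintype.card α) ≤ Real.log (Fintype.card α + 1) :=
    Real.log_le_log (by linarith) (by linarith)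
  have h4 : 1 ≤ Real.log (Fintype.card α + 1) := by
    rw [Real.le_log_iff_exp_le (by linarith)]
    linarith [Real.exp_one_lt_d9]
  linarith

/-! ### Independent sampling. -/

/-- Exponential moments of the number of hits in `N` independent samples from `p`. -/
theorem sum_prod_mul_exp_le [Fintype α] {p : α → ℝ} (hp : ∀ i, 0 ≤ p i) (hp1 : ∑ i, p i = 1)
    (N : ℕ) (s : Finset α) {σ : ℝ} (hσ : |σ| ≤ 1) :
    ∑ f : Fin N → α, (∏ k, p (f k)) *
      Real.exp (σ * (∑ k, if f k ∈ s then 1 else 0) - σ * (N * ∑ i ∈ s, p i))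
      ≤ Real.exp (N * (∑ i ∈ s, p i) * σ ^ 2) := by
  set q := ∑ i ∈ s, p i with hq
  have hq0 : 0 ≤ q := Finset.sum_nonneg fun i _ => hp i
  have h1 : ∑ f : Fin N → α, (∏ k, p (f k)) * Real.exp (σ * (∑ k, if f k ∈ s then 1 else 0))
      = (∑ i, p i * Real.exp (σ * if i ∈ s then 1 else 0)) ^ N := by
    rw [← Fin.prod_const, Finset.prod_univ_sum, Fintype.piFinset_univ]
    refine Finset.sum_congr rfl fun f _ => ?_
    rw [Finset.mul_sum, Real.exp_sum, Finset.prod_mul_distrib]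
  have h2 : ∑ i, p i * Real.exp (σ * if i ∈ s then 1 else 0) = 1 + q * (Real.exp σ - 1) := by
    have : ∀ i, p i * Real.exp (σ * if i ∈ s then 1 else 0)
        = p i + (if i ∈ s then p i else 0) * (Real.exp σ - 1) := by
      intro i
      split_ifs <;> simp
      ring
    simp_rw [this]
    rw [Finset.sum_add_distrib, ← Finset.sum_mul, Finset.sum_ite_mem, Finset.univ_inter, hp1, hq]
  have h3 : 1 + q * (Real.exp σ - 1) ≤ Real.exp (q * (Real.exp σ - 1)) := by
    linarith [Real.add_one_le_exp (q * (Real.exp σ - 1))]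
  have h0 : 0 ≤ 1 + q * (Real.exp σ - 1) := by
    rw [← h2]
    exact Finset.sum_nonneg fun i _ => mul_nonneg (hp i) (Real.exp_pos _).le
  -- The quadratic bound `exp σ - 1 - σ ≤ σ ^ 2` gives the exponent of the moment estimate.
  have h4 := le_of_abs_le (Real.abs_exp_sub_one_sub_id_le hσ)
  simp_rw [Real.exp_sub, mul_div_assoc']
  rw [← Finset.sum_div, h1, h2, div_le_iff₀ (Real.exp_pos _), ← Real.exp_add]
  refine (pow_le_pow_left₀ h0 h3 N).trans ?_
  rw [← Real.exp_nat_mul]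
  apply Real.exp_le_exp.2
  have : (N : ℝ) * q * (Real.exp σ - 1 - σ) ≤ N * q * σ ^ 2 := by gcongr
  linarith

/-- The weights that give every coordinate of `T` the value `s` per hit among the samples `f`. -/
def sampleWeight (T : Finset α) (s : ℝ) {N : ℕ} (f : Fin N → α) (i : α) : ℝ :=
  s * ∑ k, if f k = i ∧ i ∈ T then 1 else 0

theorem sum_sampleWeight (T : Finset α) (s : ℝ) {N : ℕ} (f : Fin N → α) (c : Finset α) :
    ∑ i ∈ c, sampleWeight T s f i = s * ∑ k, if f k ∈ c ∩ T then 1 else 0 := by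
  simp_rw [sampleWeight]
  rw [← Finset.mul_sum, Finset.sum_comm]
  congr 1
  refine Finset.sum_congr rfl fun k _ => ?_
  simp_rw [ite_and, Finset.sum_ite_eq, Finset.mem_inter, ite_and]

/-- Some sample of size `N` has small deviation on all members of `D`. -/
theorem exists_sample_sum_lt [Fintype α] {p : α → ℝ} (hp : ∀ i, 0 ≤ p i) (hp1 : ∑ i, p i = 1)
    (N : ℕ) (T : Finset α) (D : Finset (Finset α)) {σ : ℝ} (hσ0 : 0 ≤ σ) (hσ : σ ≤ 1)
    (A : Finset α → ℝ) (hA : ∑ c ∈ D, Real.exp (-A c) < 1 / 2) :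
    ∃ f : Fin N → α, ∀ c ∈ D,
      σ * |(∑ k, if f k ∈ c ∩ T then (1 : ℝ) else 0) - N * ∑ i ∈ c ∩ T, p i|
        ≤ σ ^ 2 * (N * ∑ i ∈ c ∩ T, p i) + A c := by
  let Z : (Fin N → α) → Finset α → ℝ := fun f c => ∑ k, if f k ∈ c ∩ T then (1 : ℝ) else 0
  let μ : Finset α → ℝ := fun c => N * ∑ i ∈ c ∩ T, p i
  -- Normalised so that its mean is at most `exp (-A c)`. Summed over both signs and all `c` the
  -- mean is below 1, so some sample has total cost below 1.
  let cost : ℝ → (Fin N → α) → Finset α → ℝ := fun τ f c =>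
    Real.exp (τ * Z f c - τ * μ c) * Real.exp (-(μ c * σ ^ 2) - A c)
  have hmom : ∀ τ : ℝ, |τ| = σ → ∀ c, ∑ f, (∏ k, p (f k)) * cost τ f c ≤ Real.exp (-A c) := by
    intro τ hτ c
    have h := sum_prod_mul_exp_le hp hp1 N (c ∩ T) (hτ.trans_le hσ)
    rw [← sq_abs, hτ] at h
    have := mul_le_mul_of_nonneg_right h (Real.exp_pos (-(μ c * σ ^ 2) - A c)).le
    rw [Finset.sum_mul, ← Real.exp_add] at this
    simp_rw [mul_assoc] at this
    refine this.trans (Real.exp_le_exp.2 (le_of_eq ?_))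
    simp only [μ]
    ring
  have htot : ∑ f : Fin N → α, ∏ k, p (f k) = 1 := by
    rw [← Fintype.piFinset_univ, ← Finset.prod_univ_sum, hp1, Finset.prod_const_one]
  obtain ⟨f, hf⟩ : ∃ f, ∑ c ∈ D, (cost σ f c + cost (-σ) f c) < 1 := by
    by_contra! hcon
    have h1 : (1 : ℝ) ≤ ∑ f : Fin N → α, (∏ k, p (f k)) *
        ∑ c ∈ D, (cost σ f c + cost (-σ) f c) := by
      rw [← htot]
      exact Finset.sum_le_sum fun f _ =>
        le_mul_of_one_le_right (Finset.prod_nonneg fun k _ => hp _) (hcon f)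
    simp_rw [Finset.mul_sum] at h1
    rw [Finset.sum_comm] at h1
    simp_rw [mul_add, Finset.sum_add_distrib] at h1
    have h2 := Finset.sum_le_sum fun c (_ : c ∈ D) => hmom σ (abs_of_nonneg hσ0) c
    have h3 := Finset.sum_le_sum fun c (_ : c ∈ D) =>
      hmom (-σ) (by rw [abs_neg, abs_of_nonneg hσ0]) c
    linarith
  refine ⟨f, fun c hc => ?_⟩
  have hpos : ∀ τ c, 0 < cost τ f c := fun τ c => mul_pos (Real.exp_pos _) (Real.exp_pos _)
  have hle : cost σ f c + cost (-σ) f c < 1 :=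
    (Finset.single_le_sum (f := fun c => cost σ f c + cost (-σ) f c)
      (fun c _ => (add_pos (hpos _ c) (hpos _ c)).le) hc).trans_lt hf
  have key : ∀ τ, cost τ f c < 1 → τ * (Z f c - μ c) ≤ σ ^ 2 * μ c + A c := by
    intro τ h
    simp only [cost] at h
    rw [← Real.exp_add, Real.exp_lt_one_iff] at h
    linarith
  have k1 := key σ (by linarith [hpos (-σ) c])
  have k2 := key (-σ) (by linarith [hpos σ c])
  change σ * |Z f c - μ c| ≤ σ ^ 2 * μ c + A c
  rcases abs_cases (Z f c - μ c) with h | h <;> rw [h.1]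
  · exact k1
  · linarith

theorem exists_sample [Fintype α] {w : α → ℝ} (hw : ∀ i, 0 ≤ w i) {d : ℝ} (hd : 0 < d)
    (hα : 2 ≤ Fintype.card α) {D : Finset (Finset α)} (hD : Spread w d D) (T : Finset α)
    {σ η : ℝ} (hσ0 : 0 < σ) (hσ : σ ≤ 1) (hη : 0 < η) {N : ℕ}
    (hN : 8 * Real.log (Fintype.card α + 1) * (∑ i ∈ T, w i) / (d * σ * η) ≤ N) :
    ∃ w' : α → ℝ, (∀ i, 0 ≤ w' i) ∧ (univ.filter fun i => w' i ≠ 0).card ≤ N ∧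
      (∀ i, i ∉ T → w' i = 0) ∧ ∑ i, w' i ≤ ∑ i ∈ T, w i ∧
      ∀ c ∈ D, |∑ i ∈ c, w' i - ∑ i ∈ c ∩ T, w i|
        ≤ σ * ∑ i ∈ c ∩ T, w i + η * ∑ i ∈ c, w i := by
  have hW0 : 0 ≤ ∑ i ∈ T, w i := Finset.sum_nonneg fun i _ => hw i
  have hnn : ∀ c : Finset α, 0 ≤ ∑ i ∈ c, w i := fun c => Finset.sum_nonneg fun i _ => hw i
  rcases hW0.eq_or_lt with hW | hW
  · refine ⟨0, fun _ => le_rfl, by simp, by simp, by simpa using hW.le, fun c _ => ?_⟩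
    have : ∑ i ∈ c ∩ T, w i = 0 := le_antisymm (hW.symm ▸
      Finset.sum_le_sum_of_subset_of_nonneg Finset.inter_subset_right fun i _ _ => hw i) (hnn _)
    simp only [this, Pi.zero_apply, Finset.sum_const_zero, sub_zero, abs_zero, mul_zero, zero_add]
    exact mul_nonneg hη.le (hnn c)
  set W := ∑ i ∈ T, w i with hWdef
  have hlog : 0 < Real.log (Fintype.card α + 1) := Real.log_pos (by
    have : (2 : ℝ) ≤ Fintype.card α := by exact_mod_cast hα
    linarith)
  have hNpos : (0 : ℝ) < N := lt_of_lt_of_le (by positivity) hN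
  let p : α → ℝ := fun i => if i ∈ T then w i / W else 0
  have hp : ∀ i, 0 ≤ p i := fun i => by
    simp only [p]
    split_ifs
    exacts [div_nonneg (hw i) hW.le, le_rfl]
  have hpsum : ∀ c : Finset α, ∑ i ∈ c ∩ T, p i = (∑ i ∈ c ∩ T, w i) / W := fun c => by
    rw [Finset.sum_div]
    exact Finset.sum_congr rfl fun i hi => if_pos (Finset.mem_inter.1 hi).2
  have hp1 : ∑ i, p i = 1 := by
    simp only [p]
    rw [Finset.sum_ite_mem, Finset.univ_inter, ← Finset.sum_div, div_self hW.ne']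
  -- The allowance `A c` uses the weight of all of `c`, not of `c ∩ T`, because the counting bound
  -- concerns whole members; it becomes the `η` error term.
  obtain ⟨f, hf⟩ := exists_sample_sum_lt hp hp1 N T (D.erase ∅) hσ0.le hσ
    (fun c => 8 * Real.log (Fintype.card α + 1) * (∑ i ∈ c, w i) / d)
    (sum_exp_neg_weight_lt hw hd hα hD)
  have hs : 0 ≤ W / N := (div_pos hW hNpos).le
  refine ⟨sampleWeight T (W / N) f, fun i => ?_, ?_, fun i hi => ?_, ?_, fun c hc => ?_⟩
  · exact mul_nonneg hs (Finset.sum_nonneg fun k _ => by split_ifs <;> norm_num)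
  · refine (Finset.card_le_card (t := univ.image f) fun i hi => ?_).trans
      (Finset.card_image_le.trans (by simp))
    by_contra hcon
    refine (Finset.mem_filter.1 hi).2 ?_
    rw [sampleWeight, Finset.sum_eq_zero, mul_zero]
    intro k _
    rw [if_neg]
    rintro ⟨rfl, _⟩
    exact hcon (Finset.mem_image_of_mem _ (Finset.mem_univ _))
  · simp [sampleWeight, hi]
  · rw [sum_sampleWeight]
    have : ∑ k, (if f k ∈ univ ∩ T then (1 : ℝ) else 0) ≤ N := by
      refine (Finset.sum_le_sum (g := fun _ => (1 : ℝ)) fun k _ => ?_).trans (by simp)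
      split_ifs <;> norm_num
    calc _ ≤ W / N * N := mul_le_mul_of_nonneg_left this hs
      _ = W := div_mul_cancel₀ _ hNpos.ne'
  · rcases eq_or_ne c ∅ with rfl | hne
    · simp
    have h := hf c (Finset.mem_erase.2 ⟨hne, hc⟩)
    rw [sum_sampleWeight]
    rw [hpsum] at h
    set x := ∑ i ∈ c ∩ T, w i
    set X := ∑ i ∈ c, w i
    set Z := ∑ k, if f k ∈ c ∩ T then (1 : ℝ) else 0
    have e1 : W / N * Z - x = W / N * (Z - N * (x / W)) := by
      field_simp
    rw [e1, abs_mul, abs_of_nonneg hs]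
    have hX : 0 ≤ X := hnn c
    have e2 : |Z - N * (x / W)| ≤ σ * (N * (x / W)) +
        8 * Real.log (Fintype.card α + 1) * X / d / σ := by
      rw [← sub_nonneg] at h ⊢
      have : σ * (N * (x / W)) + 8 * Real.log (Fintype.card α + 1) * X / d / σ -
        |Z - N * (x / W)| = (σ ^ 2 * (N * (x / W)) + 8 * Real.log (Fintype.card α + 1) * X / d
          - σ * |Z - N * (x / W)|) / σ := by
        field_simp
      rw [this]
      exact div_nonneg h hσ0.le
    refine (mul_le_mul_of_nonneg_left e2 hs).trans ?_
    rw [mul_add]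
    refine add_le_add (le_of_eq (by field_simp)) ?_
    rw [div_le_iff₀ (by positivity)] at hN
    have e3 : W / N * (8 * Real.log (Fintype.card α + 1) * X / d / σ)
        = (8 * Real.log (Fintype.card α + 1) * W) * X / (N * d * σ) := by
      field_simp
    rw [e3, div_le_iff₀ (by positivity)]
    calc _ ≤ (N * (d * σ * η)) * X := mul_le_mul_of_nonneg_right hN hX
      _ = _ := by ring

/-! ### Dyadic layers. -/

theorem sum_range_le_of_le_geom {f : ℕ → ℝ} {a b : ℝ} (hb : 0 ≤ b) (ha0 : 0 ≤ a)
    (ha : ∀ j, f j ≤ a) (hf : ∀ j, f j ≤ b * 2 ^ j) (k n : ℕ) :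
    ∑ j ∈ range n, f j ≤ k * a + b * 2 ^ n / 2 ^ k := by
  have hcount : ∀ (g : ℕ → ℝ) (t : ℕ), (∀ j, g j ≤ a) → ∑ j ∈ range t, g j ≤ t * a := by
    intro g t hg
    simpa using Finset.sum_le_card_nsmul (range t) g a fun j _ => hg j
  rcases le_total n k with h | h
  · have h1 : (n : ℝ) * a ≤ k * a := by gcongr
    have h2 : 0 ≤ b * 2 ^ n / 2 ^ k := by positivity
    linarith [hcount f n ha]
  · obtain ⟨t, rfl⟩ := Nat.exists_eq_add_of_le' h
    rw [Finset.sum_range_add]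
    have h1 : ∑ j ∈ range t, f j ≤ b * 2 ^ t := by
      calc _ ≤ ∑ j ∈ range t, b * 2 ^ j := Finset.sum_le_sum fun j _ => hf j
        _ = b * (2 ^ t - 1) := by
          rw [← Finset.mul_sum, geom_sum_eq (by norm_num)]
          norm_num
        _ ≤ b * 2 ^ t := by gcongr; linarith
    have h2 : b * 2 ^ (t + k) / 2 ^ k = b * (2 : ℝ) ^ t := by
      rw [pow_add]
      field_simp
    rw [h2]
    linarith [hcount (fun j => f (t + j)) k fun j => ha _]

/-- Levels above the scale of `X` contribute nothing positive. The top `k` remaining levels cost `η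
* X` each, and those below form a geometric series. -/
theorem sum_dyadic_le {f : ℕ → ℝ} {d X η M : ℝ} (hd : 0 < d) (hX : 0 ≤ X) (hη : 0 ≤ η)
    (hM : 0 ≤ M) (hf : ∀ j, f j ≤ η * X) (hf' : ∀ j, f j ≤ M * (d * 2 ^ j))
    (h0 : ∀ j, X < d * 2 ^ j → f j ≤ 0) (k J : ℕ) :
    ∑ j ∈ range J, f j ≤ (k * η + 2 * M / 2 ^ k) * X := by
  have hex : ∃ n, X < d * 2 ^ n := by
    obtain ⟨n, hn⟩ := pow_unbounded_of_one_lt (X / d) (one_lt_two)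
    exact ⟨n, by rwa [div_lt_iff₀' hd] at hn⟩
  classical
  set n := Nat.find hex with hn
  have hrest : 0 ≤ 2 * M / 2 ^ k * X := by positivity
  have hk : 0 ≤ k * η * X := by positivity
  have h1 : ∑ j ∈ range J, f j ≤ ∑ j ∈ range (min J n), f j := by
    rcases le_total J n with h | h
    · rw [min_eq_left h]
    · rw [min_eq_right h, ← Finset.sum_range_add_sum_Ico f h]
      have : ∑ j ∈ Ico n J, f j ≤ 0 := Finset.sum_nonpos fun j hj => h0 j <|
        (Nat.find_spec hex).trans_le (by
          have : n ≤ j := (Finset.mem_Ico.1 hj).1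
          gcongr
          norm_num)
      linarith
  refine h1.trans ?_
  rcases Nat.eq_zero_or_pos (min J n) with h | h
  · rw [h, Finset.range_zero, Finset.sum_empty]
    linarith
  refine (sum_range_le_of_le_geom (mul_nonneg hM hd.le) (mul_nonneg hη hX) hf
    (fun j => by rw [mul_assoc]; exact hf' j) k _).trans ?_
  have h2 : M * d * 2 ^ (min J n) ≤ 2 * M * X := by
    obtain ⟨t, ht⟩ := Nat.exists_eq_succ_of_ne_zero h.ne'
    have : d * 2 ^ t ≤ X := not_lt.1 (Nat.find_min hex (by omega))
    rw [ht, pow_succ]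
    nlinarith [mul_le_mul_of_nonneg_left this hM]
  have : M * d * 2 ^ (min J n) / 2 ^ k ≤ 2 * M * X / 2 ^ k := by gcongr
  calc _ ≤ k * (η * X) + 2 * M * X / 2 ^ k := by linarith
    _ = _ := by ring

theorem exists_dyadic_filtration [Fintype α] {w : α → ℝ} (hw : ∀ i, 0 ≤ w i) (d : ℝ)
    {D : Finset (Finset α)} (hD : Spread w d D) :
    ∃ V : ℕ → Finset α, V 0 = univ ∧ (∀ j, V (j + 1) ⊆ V j) ∧
      (∀ j, Spread w (d * 2 ^ j) (restrict D (V j))) ∧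
      ∀ j, ∑ i ∈ V j \ V (j + 1), w i
        ≤ d * 2 ^ (j + 1) * ((rk (restrict D (V j)) : ℝ) - rk (restrict D (V (j + 1)))) := by
  choose U hU hU' using fun (e : ℝ) (E : Finset (Finset α)) => exists_spread_restrict hw e E
  let V : ℕ → Finset α := fun n =>
    Nat.rec univ (fun j W => W ∩ (U (d * 2 ^ (j + 1)) (restrict D W))ᶜ) n
  have hV : ∀ j, V (j + 1) = V j ∩ (U (d * 2 ^ (j + 1)) (restrict D (V j)))ᶜ := fun _ => rfl
  refine ⟨V, rfl, fun j => hV j ▸ Finset.inter_subset_left, fun j => ?_, fun j => ?_⟩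
  · cases j with
    | zero =>
      have : restrict D (V 0) = D := by simp [V, restrict]
      simpa [this] using hD
    | succ j =>
      rw [hV, ← restrict_restrict]
      exact hU _ _
  · have h := hU' (d * 2 ^ (j + 1)) (restrict D (V j))
    rw [restrict_restrict, ← hV] at h
    refine le_trans (Finset.sum_le_sum_of_subset_of_nonneg (fun i hi => ?_) fun i _ _ => hw i) h
    rw [hV] at hi
    simp only [Finset.mem_sdiff, Finset.mem_inter, Finset.mem_compl, not_and, not_not] at hi
    exact hi.2 hi.1

/-- A sample of one dyadic level. -/
theorem exists_level_sample [Fintype α] {w : α → ℝ} (hw : ∀ i, 0 ≤ w i) {d : ℝ} (hd : 0 < d)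
    (hα : 2 ≤ Fintype.card α) {D : Finset (Finset α)} {V V' : Finset α}
    (hD : Spread w d (restrict D V)) (hV : V' ⊆ V)
    (hw' : ∑ i ∈ V \ V', w i ≤ d * 2 * ((rk (restrict D V) : ℝ) - rk (restrict D V')))
    {σ η : ℝ} (hσ0 : 0 < σ) (hσ : σ ≤ 1) (hη : 0 < η) :
    ∃ u : α → ℝ, (∀ i, 0 ≤ u i) ∧
      ((univ.filter fun i => u i ≠ 0).card : ℝ)
        ≤ (16 * Real.log (Fintype.card α + 1) / (σ * η) + 1)
          * ((rk (restrict D V) : ℝ) - rk (restrict D V')) ∧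
      ∀ c ∈ D, ∃ e : ℝ, |∑ i ∈ c, u i - ∑ i ∈ c ∩ (V \ V'), w i|
          ≤ σ * ∑ i ∈ c ∩ (V \ V'), w i + e ∧
        e ≤ η * ∑ i ∈ c, w i ∧ e ≤ 2 * Fintype.card α * d ∧ (∑ i ∈ c, w i < d → e ≤ 0) := by
  have hnn : ∀ c : Finset α, 0 ≤ ∑ i ∈ c, w i := fun c => Finset.sum_nonneg fun i _ => hw i
  have hlog : 0 < Real.log (Fintype.card α + 1) := Real.log_pos (by
    have : (2 : ℝ) ≤ Fintype.card α := by exact_mod_cast hα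
    linarith)
  set T := V \ V' with hT
  set Δ : ℝ := (rk (restrict D V) : ℝ) - rk (restrict D V') with hΔ
  have hrk : rk (restrict D V') ≤ rk (restrict D V) := by
    have := rk_restrict_le (restrict D V) V'
    rwa [restrict_restrict, Finset.inter_eq_right.2 hV] at this
  have hΔ0 : 0 ≤ Δ := sub_nonneg.2 (by exact_mod_cast hrk)
  set ℓ := Real.log (Fintype.card α + 1)
  obtain ⟨u, hu0, hucard, huT, husum, hu⟩ := exists_sample hw hd hα hD T hσ0 hσ hη
    (Nat.le_ceil (8 * ℓ * (∑ i ∈ T, w i) / (d * σ * η)))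
  refine ⟨u, hu0, ?_, fun c hc => ?_⟩
  · refine (Nat.cast_le.2 hucard).trans ?_
    -- The `+ 1` from rounding up is absorbed by the rank drop: a layer of positive weight has an
    -- integer drop of at least 1.
    rcases (hnn T).eq_or_lt with h0 | hpos
    · rw [← h0]
      simp only [mul_zero, zero_div, Nat.ceil_zero, Nat.cast_zero]
      positivity
    · have hΔ1 : 1 ≤ Δ := by
        have : 0 < Δ := by
          by_contra h
          have h' : Δ = 0 := le_antisymm (not_lt.1 h) hΔ0
          rw [h', mul_zero] at hw'
          linarith
        have h' : rk (restrict D V') < rk (restrict D V) := by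
          have := sub_pos.1 this
          exact_mod_cast this
        rw [hΔ, le_sub_iff_add_le']
        exact_mod_cast h'
      refine (Nat.ceil_lt_add_one (by positivity)).le.trans ?_
      rw [add_mul, one_mul]
      refine add_le_add ?_ hΔ1
      rw [div_le_iff₀ (by positivity)]
      calc 8 * ℓ * ∑ i ∈ T, w i ≤ 8 * ℓ * (d * 2 * Δ) := by gcongr
        _ = _ := by
          field_simp
          norm_num
  · have hu' : ∀ b : Finset α, ∑ i ∈ b, u i = ∑ i ∈ b ∩ T, u i := fun b =>
      (Finset.sum_subset Finset.inter_subset_left fun i hib hi =>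
        huT i fun hiT => hi (Finset.mem_inter.2 ⟨hib, hiT⟩)).symm
    have hcT : c ∩ V ∩ T = c ∩ T := by
      rw [Finset.inter_assoc, Finset.inter_eq_right.2 Finset.sdiff_subset]
    have hle : ∑ i ∈ c ∩ V, w i ≤ ∑ i ∈ c, w i :=
      Finset.sum_le_sum_of_subset_of_nonneg Finset.inter_subset_left fun i _ _ => hw i
    have hb := hu (c ∩ V) (mem_restrict.2 ⟨c, hc, rfl⟩)
    rw [hu', hcT, ← hu'] at hb
    set x := ∑ i ∈ c ∩ T, w i with hx
    have hx0 : 0 ≤ x := hnn _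
    refine ⟨|∑ i ∈ c, u i - x| - σ * x, by linarith, ?_, ?_, fun hlt => ?_⟩
    · linarith [mul_le_mul_of_nonneg_left hle hη.le]
    · have h1 : ∑ i ∈ T, w i ≤ 2 * Fintype.card α * d := by
        have h2 : Δ ≤ Fintype.card α := by
          have h3 : rk (restrict D V) ≤ Fintype.card α :=
            (rk_le_card_supp _).trans (Finset.card_le_univ _)
          have h4 : (rk (restrict D V) : ℝ) ≤ Fintype.card α := by exact_mod_cast h3
          have h5 : (0 : ℝ) ≤ rk (restrict D V') := Nat.cast_nonneg _
          linarith
        calc _ ≤ d * 2 * Δ := hw'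
          _ ≤ d * 2 * Fintype.card α := by gcongr
          _ = _ := by ring
      have h2 : ∑ i ∈ c, u i ≤ ∑ i ∈ T, w i :=
        (Finset.sum_le_sum_of_subset_of_nonneg (Finset.subset_univ c) fun i _ _ => hu0 i).trans
          husum
      have h3 : x ≤ ∑ i ∈ T, w i :=
        Finset.sum_le_sum_of_subset_of_nonneg Finset.inter_subset_right fun i _ _ => hw i
      have h4 : 0 ≤ ∑ i ∈ c, u i := Finset.sum_nonneg fun i _ => hu0 i
      have h5 : |∑ i ∈ c, u i - x| ≤ ∑ i ∈ T, w i := abs_le.2 ⟨by linarith, by linarith⟩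
      linarith [mul_nonneg hσ0.le hx0]
    -- A nonempty trace on `V` would weigh at least `d` by spreadness.
    · have hempty : c ∩ V = ∅ := by
        by_contra hne
        have := hD.le_sum hw hd.le (mem_restrict.2 ⟨c, hc, rfl⟩)
          (Finset.nonempty_iff_ne_empty.2 hne)
        linarith
      have hcT' : c ∩ T = ∅ := by rw [← hcT, hempty, Finset.empty_inter]
      rw [hu', hx, hcT']
      simp

/-- The layer samples are added up. Support sizes telescope with the ranks, and the errors are
summed by `sum_dyadic_le`, so the bound does not depend on the number of layers. -/
theorem exists_sparsifier_of_spread [Fintype α] {w : α → ℝ} (hw : ∀ i, 0 ≤ w i) {d : ℝ}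
    (hd : 0 < d) (hα : 2 ≤ Fintype.card α) {D : Finset (Finset α)} (hD : Spread w d D)
    {σ η : ℝ} (hσ0 : 0 < σ) (hσ : σ ≤ 1) (hη : 0 < η) (k : ℕ) :
    ∃ u : α → ℝ, (∀ i, 0 ≤ u i) ∧
      ((univ.filter fun i => u i ≠ 0).card : ℝ)
        ≤ (16 * Real.log (Fintype.card α + 1) / (σ * η) + 1) * rk D ∧
      ∀ c ∈ D, |∑ i ∈ c, u i - ∑ i ∈ c, w i|
        ≤ (σ + k * η + 4 * Fintype.card α / 2 ^ k) * ∑ i ∈ c, w i := by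
  obtain ⟨V, hV0, hVsub, hVspread, hVw⟩ := exists_dyadic_filtration hw d hD
  have hnn : ∀ c : Finset α, 0 ≤ ∑ i ∈ c, w i := fun c => Finset.sum_nonneg fun i _ => hw i
  choose u hu0 hucard hu using fun j : ℕ => exists_level_sample hw
    (show 0 < d * 2 ^ j by positivity) hα (hVspread j) (hVsub j)
    (by have := hVw j; rwa [pow_succ, ← mul_assoc] at this) hσ0 hσ hη
  -- Beyond this scale no trace can be nonempty, so `J` layers exhaust every member.
  obtain ⟨J, hJ⟩ : ∃ J : ℕ, ∑ i, w i < d * 2 ^ J := by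
    obtain ⟨n, hn⟩ := pow_unbounded_of_one_lt ((∑ i, w i) / d) (one_lt_two)
    exact ⟨n, by rwa [div_lt_iff₀' hd] at hn⟩
  set A := 16 * Real.log (Fintype.card α + 1) / (σ * η) + 1 with hA
  have hlog : 0 ≤ Real.log (Fintype.card α + 1) := Real.log_nonneg (by simp)
  have hA0 : 0 ≤ A := by positivity
  refine ⟨fun i => ∑ j ∈ range J, u j i, fun i => Finset.sum_nonneg fun j _ => hu0 j i, ?_, ?_⟩
  · have h1 : (univ.filter fun i => ∑ j ∈ range J, u j i ≠ 0).card
        ≤ ∑ j ∈ range J, (univ.filter fun i => u j i ≠ 0).card := by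
      refine (Finset.card_le_card fun i hi => ?_).trans Finset.card_biUnion_le
      obtain ⟨j, hj, hne⟩ := Finset.exists_ne_zero_of_sum_ne_zero (Finset.mem_filter.1 hi).2
      exact Finset.mem_biUnion.2 ⟨j, hj, Finset.mem_filter.2 ⟨Finset.mem_univ _, hne⟩⟩
    calc _ ≤ ∑ j ∈ range J, ((univ.filter fun i => u j i ≠ 0).card : ℝ) := by exact_mod_cast h1
      _ ≤ ∑ j ∈ range J, A * ((rk (restrict D (V j)) : ℝ) - rk (restrict D (V (j + 1)))) :=
        Finset.sum_le_sum fun j _ => hucard j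
      _ = A * ((rk (restrict D (V 0)) : ℝ) - rk (restrict D (V J))) := by
        rw [← Finset.mul_sum, Finset.sum_range_sub' fun j => (rk (restrict D (V j)) : ℝ)]
      _ ≤ A * rk D := by
        gcongr
        have h2 : (rk (restrict D (V 0)) : ℝ) ≤ rk D := by exact_mod_cast rk_restrict_le D (V 0)
        have h3 : (0 : ℝ) ≤ rk (restrict D (V J)) := Nat.cast_nonneg _
        linarith
  · intro c hc
    choose e he1 he2 he3 he4 using fun j => hu j c hc
    set X := ∑ i ∈ c, w i with hX
    have hsplit : X = ∑ j ∈ range J, ∑ i ∈ c ∩ (V j \ V (j + 1)), w i := by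
      have h1 : ∀ j, ∑ i ∈ c ∩ (V j \ V (j + 1)), w i
          = ∑ i ∈ c ∩ V j, w i - ∑ i ∈ c ∩ V (j + 1), w i := fun j => by
        rw [eq_sub_iff_add_eq, ← Finset.sum_union, ← Finset.inter_union_distrib_left,
          Finset.sdiff_union_of_subset (hVsub j)]
        exact Finset.disjoint_of_subset_left Finset.inter_subset_right
          (Finset.disjoint_of_subset_right Finset.inter_subset_right Finset.sdiff_disjoint)
      have h2 : c ∩ V J = ∅ := by
        by_contra hne
        have h3 := (hVspread J).le_sum hw (by positivity) (mem_restrict.2 ⟨c, hc, rfl⟩)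
          (Finset.nonempty_iff_ne_empty.2 hne)
        have h4 : ∑ i ∈ c ∩ V J, w i ≤ ∑ i, w i :=
          Finset.sum_le_sum_of_subset_of_nonneg (Finset.subset_univ _) fun i _ _ => hw i
        linarith
      simp_rw [h1]
      rw [Finset.sum_range_sub' fun j => ∑ i ∈ c ∩ V j, w i, h2, hV0, Finset.inter_univ]
      simp [hX]
    have hdy := sum_dyadic_le (f := e) (M := 2 * Fintype.card α) hd (hnn c) hη.le (by positivity)
      he2 he3 he4 k J
    rw [Finset.sum_comm]
    calc |∑ j ∈ range J, ∑ i ∈ c, u j i - X|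
        = |∑ j ∈ range J, (∑ i ∈ c, u j i - ∑ i ∈ c ∩ (V j \ V (j + 1)), w i)| := by
          rw [Finset.sum_sub_distrib, ← hsplit]
      _ ≤ ∑ j ∈ range J, (σ * ∑ i ∈ c ∩ (V j \ V (j + 1)), w i + e j) :=
          (Finset.abs_sum_le_sum_abs _ _).trans (Finset.sum_le_sum fun j _ => he1 j)
      _ = σ * X + ∑ j ∈ range J, e j := by
          rw [Finset.sum_add_distrib, ← Finset.mul_sum, ← hsplit]
      _ ≤ σ * X + (k * η + 2 * (2 * Fintype.card α) / 2 ^ k) * X := by linarith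
      _ = _ := by ring

/-- Positive weights are spread at some positive level. -/
theorem exists_spread_of_pos [Fintype α] {w : α → ℝ} (D : Finset (Finset α))
    (hpos : ∀ i ∈ supp D, 0 < w i) : ∃ d : ℝ, 0 < d ∧ Spread w d D := by
  obtain ⟨d, hd, hdw⟩ : ∃ d : ℝ, 0 < d ∧ ∀ i ∈ supp D, d ≤ w i := by
    rcases (supp D).eq_empty_or_nonempty with h | h
    · exact ⟨1, one_pos, by simp [h]⟩
    · obtain ⟨i, hi, hmin⟩ := Finset.exists_min_image (supp D) w h
      exact ⟨w i, hpos i hi, hmin⟩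
  refine ⟨d, hd, fun S => ?_⟩
  have hsub : supp (contract D S) ⊆ supp D :=
    Finset.biUnion_subset_biUnion_of_subset_left _ (contract_subset D S)
  calc d * rk (contract D S) ≤ d * (supp (contract D S)).card := by
        gcongr
        exact rk_le_card_supp _
    _ = ∑ i ∈ supp (contract D S), d := by rw [Finset.sum_const, nsmul_eq_mul, mul_comm]
    _ ≤ _ := Finset.sum_le_sum fun i hi => hdw i (hsub hi)

/-- Coordinates of zero weight are discarded; on the others some positive starting scale `d` exists,
and its size does not enter the bound. -/
theorem exists_sparsifier [Fintype α] {w : α → ℝ} (hw : ∀ i, 0 ≤ w i)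
    (hα : 2 ≤ Fintype.card α) (D : Finset (Finset α))
    {σ η : ℝ} (hσ0 : 0 < σ) (hσ : σ ≤ 1) (hη : 0 < η) (k : ℕ) :
    ∃ u : α → ℝ, (∀ i, 0 ≤ u i) ∧
      ((univ.filter fun i => u i ≠ 0).card : ℝ)
        ≤ (16 * Real.log (Fintype.card α + 1) / (σ * η) + 1) * rk D ∧
      ∀ c ∈ D, |∑ i ∈ c, u i - ∑ i ∈ c, w i|
        ≤ (σ + k * η + 4 * Fintype.card α / 2 ^ k) * ∑ i ∈ c, w i := by
  set P : Finset α := univ.filter fun i => 0 < w i with hP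
  obtain ⟨d, hd, hD⟩ := exists_spread_of_pos (w := w) (restrict D P) (fun i hi => by
    obtain ⟨c, hc, hic⟩ := mem_supp.1 hi
    obtain ⟨b, -, rfl⟩ := mem_restrict.1 hc
    exact (Finset.mem_filter.1 (Finset.mem_inter.1 hic).2).2)
  obtain ⟨u, hu0, hucard, hu⟩ := exists_sparsifier_of_spread hw hd hα hD hσ0 hσ hη k
  have hlog : 0 ≤ Real.log (Fintype.card α + 1) := Real.log_nonneg (by simp)
  refine ⟨fun i => if i ∈ P then u i else 0, fun i => ?_, ?_, fun c hc => ?_⟩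
  · dsimp only
    split_ifs
    exacts [hu0 i, le_rfl]
  · have h1 : (univ.filter fun i => (if i ∈ P then u i else 0) ≠ 0).card
        ≤ (univ.filter fun i => u i ≠ 0).card := by
      refine Finset.card_le_card fun i hi => ?_
      simp only [Finset.mem_filter, Finset.mem_univ, true_and] at hi ⊢
      intro h
      simp [h] at hi
    have h2 : (rk (restrict D P) : ℝ) ≤ rk D := by exact_mod_cast rk_restrict_le D P
    calc _ ≤ ((univ.filter fun i => u i ≠ 0).card : ℝ) := by exact_mod_cast h1
      _ ≤ _ := hucard
      _ ≤ _ := by gcongr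
  · have h1 : ∑ i ∈ c ∩ P, w i = ∑ i ∈ c, w i :=
      Finset.sum_subset Finset.inter_subset_left fun i hic hi => by
        by_contra hne
        exact hi (Finset.mem_inter.2 ⟨hic, Finset.mem_filter.2
          ⟨Finset.mem_univ _, (hw i).lt_of_ne' hne⟩⟩)
    have h2 := hu (c ∩ P) (mem_restrict.2 ⟨c, hc, rfl⟩)
    rw [Finset.sum_ite_mem, ← h1]
    exact h2

end SetFamily

/-! ### From set families back to codes. -/

namespace SetFamily

theorem IsChain.exists_separating {α : Type*} {D : Finset (Finset α)} :
    ∀ {l : List α}, IsChain D l → ∀ i : Fin l.length,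
      ∃ c ∈ D, l.get i ∈ c ∧ ∀ j, i < j → l.get j ∉ c
  | [], _, i => i.elim0
  | a :: l, ⟨⟨c, hc, hac, hb⟩, hl⟩, i => by
    refine Fin.cases ?_ (fun i => ?_) i
    · refine ⟨c, hc, hac, fun j hj => ?_⟩
      obtain ⟨j, rfl⟩ := Fin.exists_succ_eq.2 hj.ne'
      exact hb _ (List.get_mem l j)
    · obtain ⟨e, he, hie, hej⟩ := hl.exists_separating i
      refine ⟨e, he, hie, fun j hj => ?_⟩
      obtain ⟨j, rfl⟩ := Fin.exists_succ_eq.2 (((Fin.succ_pos i).trans hj).ne')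
      exact hej j (Fin.succ_lt_succ_iff.1 hj)

end SetFamily

namespace Code

variable {m : ℕ}

/-- The set of coordinates at which a word is `true`. -/
def onSet (c : Fin m → Bool) : Finset (Fin m) := univ.filter fun i => c i = true

theorem weight_eq_sum_onSet (w : Fin m → ℝ≥0) (c : Fin m → Bool) :
    weight w c = ∑ i ∈ onSet c, (w i : ℝ) := by
  simp only [weight, onSet, mul_ite, mul_one, mul_zero, Finset.sum_filter]

/-- The supports of the words of a code. -/
noncomputable def family (C : Code m) : Finset (Finset (Fin m)) :=
  C.toFinite.toFinset.image onSet

theorem mem_family {C : Code m} {s : Finset (Fin m)} : s ∈ family C ↔ ∃ c ∈ C, onSet c = s := by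
  simp [family]

theorem rk_family_le_chainLength (C : Code m) : SetFamily.rk (family C) ≤ chainLength C := by
  obtain ⟨l, hl, hlen⟩ := SetFamily.exists_chain (family C)
  rw [← hlen]
  refine (isGreatest_chainLength C).2 ?_
  have h : ∀ i : Fin l.length, ∃ c : C, (c : Fin m → Bool) (l.get i) = true ∧
      ∀ j, i < j → (c : Fin m → Bool) (l.get j) = false := fun i => by
    obtain ⟨s, hs, his, hj⟩ := hl.exists_separating i
    obtain ⟨c, hc, rfl⟩ := mem_family.1 hs
    exact ⟨⟨c, hc⟩, by simpa [onSet] using his, fun j hij => by simpa [onSet] using hj j hij⟩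
  choose c hc1 hc2 using h
  refine ⟨l.get, c, List.nodup_iff_injective_get.1 hl.nodup, fun i j hij => ?_, hc1, hc2⟩
  -- Distinctness of the words is automatic: the later of two indices gives a coordinate where the
  -- words differ.
  by_contra hne
  rcases lt_or_gt_of_ne hne with h | h
  · have := hc2 i j h
    rw [hij, hc1] at this
    exact absurd this (by simp)
  · have := hc2 j i h
    rw [← hij, hc1] at this
    exact absurd this (by simp)

theorem exists_sparsifier {m : ℕ} (hm : 2 ≤ m) (C : Code m) (w : Fin m → ℝ≥0) {ε : ℝ}
    (hε : 0 < ε) (hε1 : ε < 1) (hmε : 1 ≤ m * ε ^ 2) :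
    ∃ w' : Fin m → ℝ≥0, IsSparsifier C w ε w' ∧
      ((Function.support w').ncard : ℝ)
        ≤ 8196 * (chainLength C * Real.log m ^ 2 / ε ^ 2) := by
  have hm' : (2 : ℝ) ≤ m := by exact_mod_cast hm
  have hlog2 : (1 : ℝ) / 2 ≤ Real.log 2 := by linarith [Real.log_two_gt_d9]
  have hlogm : 1 / 2 ≤ Real.log m := hlog2.trans (Real.log_le_log (by norm_num) hm')
  have hlogm1 : Real.log (m + 1) ≤ 2 * Real.log m := by
    have : 2 * Real.log m = Real.log ((m : ℝ) ^ 2) := by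
      rw [Real.log_pow]
      norm_num
    rw [this]
    exact Real.log_le_log (by linarith) (by nlinarith)
  -- Chosen so that `2 ^ k ≥ 16 * m ^ 2`, which with `m * ε ≥ 1` puts the geometric tail below `ε /
  -- 4`. Since `k ≤ 16 * log m`, the choice of `η` below makes `k * η ≤ ε / 4` as well.
  set k := 2 * Nat.log 2 m + 6 with hk
  have hkle : (k : ℝ) ≤ 16 * Real.log m := by
    have h1 : (2 : ℝ) ^ Nat.log 2 m ≤ m := by
      exact_mod_cast Nat.pow_log_le_self 2 (by omega : m ≠ 0)
    have h2 := Real.log_le_log (by positivity) h1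
    rw [Real.log_pow] at h2
    have h3 : (Nat.log 2 m : ℝ) * (1 / 2) ≤ Nat.log 2 m * Real.log 2 := by gcongr
    rw [hk]
    push_cast
    linarith
  have h2k : 16 * (m : ℝ) ^ 2 ≤ 2 ^ k := by
    have h1 : (m : ℝ) ≤ 2 ^ (Nat.log 2 m + 1) := by
      exact_mod_cast (Nat.lt_pow_succ_log_self (by norm_num : 1 < 2) m).le
    calc 16 * (m : ℝ) ^ 2 ≤ 16 * (2 ^ (Nat.log 2 m + 1)) ^ 2 := by gcongr
      _ = (2 : ℝ) ^ k := by
        rw [hk]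
        ring
  have hη : 0 < ε / (64 * Real.log m) := by positivity
  obtain ⟨u, hu0, hucard, hu⟩ := SetFamily.exists_sparsifier (w := fun i => (w i : ℝ))
    (fun i => (w i).2) (by simpa using hm) (family C) (σ := ε / 4) (by positivity) (by linarith)
    hη k
  simp only [Fintype.card_fin] at hucard hu
  refine ⟨fun i => (u i).toNNReal, fun c hc => ?_, ?_⟩
  · have h := hu (onSet c) (mem_family.2 ⟨c, hc, rfl⟩)
    rw [weight_eq_sum_onSet, weight_eq_sum_onSet]
    simp only [Real.coe_toNNReal _ (hu0 _)]
    set X := ∑ i ∈ onSet c, (w i : ℝ)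
    have hX : 0 ≤ X := Finset.sum_nonneg fun i _ => (w i).2
    have h1 : (k : ℝ) * (ε / (64 * Real.log m)) ≤ ε / 4 := by
      calc (k : ℝ) * (ε / (64 * Real.log m)) ≤ 16 * Real.log m * (ε / (64 * Real.log m)) := by
            gcongr
        _ = ε / 4 := by
          field_simp
          norm_num
    have h2 : 4 * (m : ℝ) / 2 ^ k ≤ ε / 4 := by
      have h3 : 1 ≤ m * ε := hmε.trans (by gcongr; nlinarith)
      rw [div_le_iff₀ (by positivity)]
      calc 4 * (m : ℝ) ≤ 4 * m * (m * ε) := le_mul_of_one_le_right (by positivity) h3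
        _ = ε / 4 * (16 * m ^ 2) := by ring
        _ ≤ _ := by gcongr
    have h4 : (ε / 4 + k * (ε / (64 * Real.log m)) + 4 * m / 2 ^ k) * X ≤ ε * X := by
      gcongr
      linarith
    have h5 := abs_le.1 (h.trans h4)
    exact ⟨by linarith [h5.1], by linarith [h5.2]⟩
  · have hsupp : Function.support (fun i => (u i).toNNReal)
        = (univ.filter fun i => u i ≠ 0 : Finset (Fin m)) := by
      ext i
      simp [(hu0 i).lt_iff_ne']
    rw [hsupp, Set.ncard_coe_finset]
    have h1 : (SetFamily.rk (family C) : ℝ) ≤ chainLength C := by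
      exact_mod_cast rk_family_le_chainLength C
    have h2 : 16 * Real.log (m + 1) / (ε / 4 * (ε / (64 * Real.log m))) + 1
        ≤ 8196 * (Real.log m ^ 2 / ε ^ 2) := by
      have h3 : 16 * Real.log (m + 1) / (ε / 4 * (ε / (64 * Real.log m)))
          ≤ 8192 * (Real.log m ^ 2 / ε ^ 2) := by
        calc _ ≤ 16 * (2 * Real.log m) / (ε / 4 * (ε / (64 * Real.log m))) := by gcongr
          _ = _ := by
            field_simp
            norm_num
      have h4 : 1 ≤ 4 * (Real.log m ^ 2 / ε ^ 2) := by
        rw [mul_div_assoc', le_div_iff₀ (by positivity)]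
        nlinarith
      linarith
    have h5 : 0 ≤ Real.log m ^ 2 / ε ^ 2 := by positivity
    calc _ ≤ _ := hucard
      _ ≤ 8196 * (Real.log m ^ 2 / ε ^ 2) * chainLength C := by gcongr
      _ = _ := by ring

theorem weight_zero (c : Fin m → Bool) : weight 0 c = 0 := by simp [weight]

theorem eq_false_of_chainLength_eq_zero {C : Code m} (h : chainLength C = 0) {c : Fin m → Bool}
    (hc : c ∈ C) (i : Fin m) : c i = false := by
  by_contra hi
  have hmem : onSet c ∈ family C := mem_family.2 ⟨c, hc, rfl⟩
  have := SetFamily.rk_pos hmem ⟨i, by simpa [onSet] using hi⟩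
  have := rk_family_le_chainLength C
  omega

end Code

/-! ### The log log factor and the degenerate cases. -/

/-- `log (log m)` vanishes only at `m = e`. It is negative at 2, and positive and increasing from 3
on, so its square is smallest at 2 or 3. -/
theorem exists_pos_le_sq_log_log :
    ∃ b : ℝ, 0 < b ∧ b ≤ 1 ∧ ∀ m : ℕ, 2 ≤ m → b ≤ Real.log (Real.log m) ^ 2 := by
  have h2 : Real.log (Real.log 2) < 0 :=
    Real.log_neg (Real.log_pos (by norm_num)) (by linarith [Real.log_two_lt_d9])
  have h3 : 1 < Real.log 3 := by
    rw [Real.lt_log_iff_exp_lt (by norm_num)]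
    linarith [Real.exp_one_lt_d9]
  have h3' : 0 < Real.log (Real.log 3) := Real.log_pos h3
  refine ⟨min 1 (min (Real.log (Real.log 2) ^ 2) (Real.log (Real.log 3) ^ 2)),
    lt_min one_pos (lt_min (sq_pos_of_neg h2) (by positivity)), min_le_left _ _,
    fun m hm => ?_⟩
  rcases hm.eq_or_lt with rfl | hm
  · exact (min_le_right _ _).trans (min_le_left _ _)
  · refine ((min_le_right _ _).trans (min_le_right _ _)).trans ?_
    have hm3 : (3 : ℝ) ≤ m := by exact_mod_cast hm
    have := Real.log_le_log (by norm_num) hm3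
    have := Real.log_le_log (by linarith) this
    gcongr

theorem mainTheorem2 :
    ∃ K : ℝ, 0 < K ∧
      ∀ (m : ℕ), 2 ≤ m →
      ∀ (C : Code m) (w : Fin m → ℝ≥0) (ε : ℝ), 0 < ε →
        ∃ w' : Fin m → ℝ≥0, Code.IsSparsifier C w ε w' ∧
          ((Function.support w').ncard : ℝ) ≤
            K * ((Code.chainLength C : ℝ) * Real.log m ^ 2 * Real.log (Real.log m) ^ 2
              / ε ^ 2) := by
  obtain ⟨b, hb, hb1, hbm⟩ := exists_pos_le_sq_log_log
  refine ⟨8196 / b, by positivity, fun m hm C w ε hε => ?_⟩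
  have hbound : 8196 * (Code.chainLength C * Real.log m ^ 2 / ε ^ 2) ≤ 8196 / b *
      ((Code.chainLength C : ℝ) * Real.log m ^ 2 * Real.log (Real.log m) ^ 2 / ε ^ 2) := by
    calc 8196 * (Code.chainLength C * Real.log m ^ 2 / ε ^ 2)
        = 8196 / b * ((Code.chainLength C : ℝ) * Real.log m ^ 2 * b / ε ^ 2) := by
          field_simp
      _ ≤ _ := by
          gcongr
          exact hbm m hm
  have hzero : (((Function.support (0 : Fin m → ℝ≥0)).ncard : ℕ) : ℝ) ≤ 8196 / b *
      ((Code.chainLength C : ℝ) * Real.log m ^ 2 * Real.log (Real.log m) ^ 2 / ε ^ 2) := by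
    rw [Function.support_zero, Set.ncard_empty, Nat.cast_zero]
    positivity
  have hwt : ∀ c, 0 ≤ Code.weight w c := fun c => by
    rw [Code.weight_eq_sum_onSet]
    exact Finset.sum_nonneg fun i _ => (w i).2
  rcases le_or_gt 1 ε with h1 | h1
  -- For `ε ≥ 1` the lower bound is nonpositive, so zero weights suffice.
  · refine ⟨0, fun c _ => ?_, hzero⟩
    rw [Code.weight_zero]
    exact ⟨mul_nonpos_of_nonpos_of_nonneg (by linarith) (hwt c),
      mul_nonneg (by linarith) (hwt c)⟩
  rcases Nat.eq_zero_or_pos (Code.chainLength C) with h0 | h0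
  · refine ⟨0, fun c hc => ?_, hzero⟩
    have : Code.weight w c = 0 := by
      simp [Code.weight, Code.eq_false_of_chainLength_eq_zero h0 hc]
    simp [this, Code.weight_zero]
  rcases le_or_gt 1 ((m : ℝ) * ε ^ 2) with h2 | h2
  · obtain ⟨w', hw', hcard⟩ := Code.exists_sparsifier hm C w hε h1 h2
    exact ⟨w', hw', hcard.trans hbound⟩
  -- When `m < 1 / ε ^ 2` and the chain length is positive, the bound already exceeds `m`, so `w`
  -- itself is kept.
  · refine ⟨w, fun c _ => ?_, le_trans ?_ hbound⟩
    · have := mul_nonneg hε.le (hwt c)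
      exact ⟨by linarith, by linarith⟩
    · have h3 : ((Function.support w).ncard : ℝ) ≤ m := by
        have := Set.ncard_le_card (Function.support w)
        rw [Nat.card_fin] at this
        exact_mod_cast this
      have h4 : (1 : ℝ) ≤ Code.chainLength C := by exact_mod_cast h0
      have hlogm : 1 / 2 ≤ Real.log m := by
        have := Real.log_le_log (by norm_num) (show (2 : ℝ) ≤ m by exact_mod_cast hm)
        linarith [Real.log_two_gt_d9]
      have h5 : 1 ≤ 8196 * (Code.chainLength C * Real.log m ^ 2) := by
        have : 1 * (1 / 2 : ℝ) ^ 2 ≤ Code.chainLength C * Real.log m ^ 2 := by gcongr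
        linarith
      rw [mul_div_assoc', le_div_iff₀ (by positivity)]
      have : ((Function.support w).ncard : ℝ) * ε ^ 2 ≤ m * ε ^ 2 := by gcongr
      linarith
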